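/- Let $\mathbb D$ be the open unit disk of $\mathbb C$. For $0<p<\infty$ and $g$ analytic in $\mathbb D$ put $$\|g\|_p=\sup_{0<r<1}\Big(\frac1{2\pi}\int_0^{2\pi}|g(re^{i\theta})|^p\,d\theta\Big)^{1/p}\in[0,\infty],$$ and let $H^p$ be the space of all analytic $g:\mathbb D\to\mathbb C$ with $\|g\|_p<\infty$. Let $2\le p<\infty$. Then there is a constant $C>0$, depending only on $p$, such that for every $f\in H^p$ and every analytic self-map $\varphi:\mathbb D\to\mathbb D$ with $f(0)=\varphi(0)=0$ one has $f\circ\varphi\in H^p$ and $$\|f\circ\varphi\|_p\le C\,\|f\|_p\,\|\varphi\|_p^{2/p}.$$ -/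

import Mathlib

open scoped ENNReal

/-- The `L^p` norm, with respect to normalized arc length `|dζ| / (2π)` on the unit circle, of the
dilate `ζ ↦ f (r ζ)`. It takes values in `[0, ∞]`. -/
noncomputable def dilateNorm (p r : ℝ) (f : ℂ → ℂ) : ℝ≥0∞ :=
  ((ENNReal.ofReal (2 * Real.pi))⁻¹ *
    ∫⁻ θ in Set.Ioc (0 : ℝ) (2 * Real.pi), ‖f (circleMap 0 r θ)‖ₑ ^ p) ^ (1 / p)

/-- The Hardy norm `‖f‖_p = sup_{0 < r < 1} ‖f(r ·)‖_p`, with values in `[0, ∞]`; only the values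
of `f` in the open unit disk matter. -/
noncomputable def hardyNorm (p : ℝ) (f : ℂ → ℂ) : ℝ≥0∞ :=
  ⨆ r ∈ Set.Ioo (0 : ℝ) 1, dilateNorm p r f

/-- Membership in the Hardy space `H^p` of the open unit disk. -/
def MemHardy (p : ℝ) (f : ℂ → ℂ) : Prop :=
  AnalyticOnNhd ℂ f (Metric.ball 0 1) ∧ hardyNorm p f < ∞

/-- `φ` is an analytic self-map of the open unit disk. -/
def IsAnalyticSelfMap (φ : ℂ → ℂ) : Prop :=
  AnalyticOnNhd ℂ φ (Metric.ball 0 1) ∧ Set.MapsTo φ (Metric.ball 0 1) (Metric.ball 0 1)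

/-! The crux is a majorant `‖f w‖ ^ p ≤ A * M * (‖w‖ / R) ^ 2 + Re (H w)` on `‖w‖ < R`, where `M` is
the `p`-th mean of `f` on the circle of radius `R`, and `H` is holomorphic with `H 0 = 0`
(`exists_re_majorant`). Put `w = φ z` and average over a circle of radius `r < R`: `Re (H ∘ φ)` has
mean zero, which leaves the mean of `‖φ‖ ^ 2`. Jensen bounds that by the `2 / p` power of the `p`-th
mean of `φ`, and a `p`-th root gives the claim.

`H` is the Herglotz integral of `‖f‖ ^ p` minus its first order Taylor polynomial at `0`. Near `0`
both `‖f‖ ^ p` (Schwarz, `p ≥ 2`) and `Re H` are `O(‖w‖ ^ 2)`; farther out the Poisson integral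
dominates `‖f‖ ^ p`, and the subtracted polynomial is absorbed by the quadratic term. -/

open Metric Real

/-! ### Jensen's inequality -/

/-- The tangent line inequality for the convex function `x ↦ x ^ p`. -/
lemma rpow_add_mul_sub_le_rpow {p a x : ℝ} (hp : 1 ≤ p) (ha : 0 ≤ a) (hx : 0 ≤ x) :
    a ^ p + p * a ^ (p - 1) * (x - a) ≤ x ^ p := by
  rcases ha.eq_or_lt with rfl | ha
  · rcases hp.eq_or_lt with rfl | hp
    · simp
    · rw [zero_rpow (by linarith), zero_rpow (by linarith)]
      simpa using rpow_nonneg hx p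
  · have h := one_add_mul_self_le_rpow_one_add (s := x / a - 1)
      (by have := div_nonneg hx ha.le; linarith) hp
    have e : x ^ p = a ^ p * (1 + (x / a - 1)) ^ p := by
      rw [← mul_rpow ha.le (by simpa using div_nonneg hx ha.le)]
      congr 1
      field_simp
      ring
    have e' : a ^ p = a ^ (p - 1) * a := by
      rw [← rpow_add_one ha.ne']
      simp
    rw [e]
    refine le_trans (le_of_eq ?_) (mul_le_mul_of_nonneg_left h (by positivity))
    rw [e']
    field_simp

/-- Jensen's inequality for weighted circle averages and the power function. -/
lemma rpow_circleAverage_mul_le {k x : ℂ → ℝ} {R p : ℝ} (hp : 1 ≤ p) (hR : 0 ≤ R)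
    (hk : ContinuousOn k (sphere 0 R)) (hx : ContinuousOn x (sphere 0 R))
    (hk0 : ∀ ζ ∈ sphere (0 : ℂ) R, 0 ≤ k ζ) (hx0 : ∀ ζ ∈ sphere (0 : ℂ) R, 0 ≤ x ζ)
    (hk1 : circleAverage k 0 R = 1) :
    circleAverage (fun ζ ↦ k ζ * x ζ) 0 R ^ p ≤ circleAverage (fun ζ ↦ k ζ * x ζ ^ p) 0 R := by
  set a := circleAverage (fun ζ ↦ k ζ * x ζ) 0 R with ha_def
  have hkx := (hk.mul hx).circleIntegrable hR
  have hkxp : CircleIntegrable (fun ζ ↦ k ζ * x ζ ^ p) 0 R :=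
    (hk.mul (hx.rpow_const fun _ _ ↦ Or.inr (by linarith))).circleIntegrable hR
  have hki := hk.circleIntegrable hR
  have ha : 0 ≤ a := circleAverage_nonneg_of_nonneg fun ζ hζ ↦ by
    rw [abs_of_nonneg hR] at hζ
    exact mul_nonneg (hk0 ζ hζ) (hx0 ζ hζ)
  have h1 : CircleIntegrable (fun ζ ↦ (a ^ p - p * a ^ (p - 1) * a) • k ζ) 0 R :=
    (continuousOn_const.mul hk).circleIntegrable hR
  have h2 : CircleIntegrable (fun ζ ↦ (p * a ^ (p - 1)) • (k ζ * x ζ)) 0 R :=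
    (continuousOn_const.mul (hk.mul hx)).circleIntegrable hR
  -- Tangent line at the mean `a`: since `k` has average 1, the linear term averages to zero.
  have key := circleAverage_mono (h1.add h2) hkxp (fun ζ hζ ↦ by
    rw [abs_of_nonneg hR] at hζ
    have := mul_le_mul_of_nonneg_left (rpow_add_mul_sub_le_rpow hp ha (hx0 ζ hζ)) (hk0 ζ hζ)
    refine le_trans (le_of_eq ?_) this
    simp only [Pi.add_apply, smul_eq_mul]
    ring)
  rw [circleAverage_add h1 h2, circleAverage_fun_smul, circleAverage_fun_smul, hk1, ← ha_def] at key
  simp only [smul_eq_mul] at key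
  linarith

/-! ### Poisson kernel estimates -/

lemma poissonKernel_nonneg {w ζ : ℂ} {R : ℝ} (hw : ‖w‖ < R) (hζ : ζ ∈ sphere (0 : ℂ) R) :
    0 ≤ poissonKernel 0 w ζ := by
  have : ‖ζ‖ = R := by simpa using hζ
  rw [poissonKernel_def]
  simp only [sub_zero, this]
  have := norm_nonneg w
  exact div_nonneg (by nlinarith) (by positivity)

lemma poissonKernel_le {w ζ : ℂ} {R : ℝ} (hw : ‖w‖ < R) (hζ : ζ ∈ sphere (0 : ℂ) R) :
    poissonKernel 0 w ζ ≤ (R + ‖w‖) / (R - ‖w‖) := by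
  simpa [poissonKernel_eq_re_herglotzRieszKernel, herglotzRieszKernel_def] using
    re_herglotzRieszKernel_le hζ (mem_ball_zero_iff.2 hw)

lemma continuousOn_poissonKernel {w : ℂ} {R : ℝ} (hw : ‖w‖ < R) :
    ContinuousOn (poissonKernel 0 w) (sphere 0 R) := by
  have := continuousOn_herglotzRieszKernel_sphere (mem_ball_zero_iff.2 hw)
  rw [abs_of_nonneg ((norm_nonneg w).trans hw.le)] at this
  rw [poissonKernel_eq_re_herglotzRieszKernel]
  exact Complex.continuous_re.comp_continuousOn this

/-- The power `‖f‖ ^ p` of a holomorphic function is dominated by its Poisson integral. -/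
lemma norm_rpow_le_circleAverage_poissonKernel {f : ℂ → ℂ} {w : ℂ} {R p : ℝ} (hp : 1 ≤ p)
    (hw : ‖w‖ < R) (hf : DiffContOnCl ℂ f (ball 0 R)) :
    ‖f w‖ ^ p ≤ circleAverage (fun ζ ↦ poissonKernel 0 w ζ * ‖f ζ‖ ^ p) 0 R := by
  have hR : 0 < R := (norm_nonneg w).trans_lt hw
  have hwb : w ∈ ball (0 : ℂ) R := mem_ball_zero_iff.2 hw
  have hfc : ContinuousOn f (sphere 0 R) :=
    hf.2.mono (sphere_subset_closedBall.trans_eq (closure_ball 0 hR.ne').symm)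
  have hk := continuousOn_poissonKernel hw
  have hk1 : circleAverage (poissonKernel 0 w) 0 R = 1 := by
    have h := (diffContOnCl_const (c := (1 : ℂ)) (s := ball 0 R)
      (𝕜 := ℂ)).circleAverage_poissonKernel_smul hwb
    have h' := Complex.reCLM.circleAverage_comp_comm (c := 0) (R := R)
      (f := poissonKernel 0 w • fun _ ↦ (1 : ℂ)) ((hk.smul continuousOn_const).circleIntegrable hR.le)
    rw [h] at h'
    simpa [Function.comp_def] using h'
  refine le_trans (rpow_le_rpow (norm_nonneg _) ?_ (by linarith))
    (rpow_circleAverage_mul_le hp hR.le hk hfc.norm (fun ζ hζ ↦ poissonKernel_nonneg hw hζ)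
      (fun _ _ ↦ norm_nonneg _) hk1)
  have h := hf.circleAverage_poissonKernel_smul hwb
  rw [← h, circleAverage_def, circleAverage_def, norm_smul, smul_eq_mul, norm_of_nonneg (by positivity)]
  refine mul_le_mul_of_nonneg_left ?_ (by positivity)
  refine (intervalIntegral.norm_integral_le_integral_norm (by positivity)).trans (le_of_eq ?_)
  refine intervalIntegral.integral_congr fun θ _ ↦ ?_
  simp [abs_of_nonneg (poissonKernel_nonneg hw (circleMap_mem_sphere 0 hR.le θ))]

lemma herglotzRieszKernel_zero_sub_taylor {w ζ : ℂ} (hζ : ζ ≠ 0) (hw : ζ ≠ w) :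
    herglotzRieszKernel 0 w ζ - 1 - 2 * (w / ζ) = 2 * (w / ζ) ^ 2 / (1 - w / ζ) := by
  have h1 : ζ - w ≠ 0 := sub_ne_zero.2 hw
  have h2 : 1 - w / ζ ≠ 0 := by
    rw [one_sub_div hζ]
    exact div_ne_zero h1 hζ
  rw [herglotzRieszKernel_def, sub_zero, sub_zero]
  field_simp
  ring

/-- For `‖q‖ ≥ 1/2`, `1 + 2‖q‖ ≤ 4‖q‖ ≤ 8‖q‖ ^ 2`. With `q = w / ζ` this absorbs the Taylor
polynomial away from the centre. -/
lemma one_add_two_re_le {q : ℂ} (hq : 1 / 2 ≤ ‖q‖) : 1 + 2 * q.re ≤ 8 * ‖q‖ ^ 2 := by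
  have := Complex.re_le_norm q
  nlinarith

/-- The Poisson kernel is bounded below by its first order Taylor polynomial up to a quadratic
error. -/
lemma neg_le_poissonKernel_sub_taylor {w ζ : ℂ} {R : ℝ} (hw : ‖w‖ < R)
    (hζ : ζ ∈ sphere (0 : ℂ) R) :
    -(8 * (‖w‖ / R) ^ 2) ≤ poissonKernel 0 w ζ - 1 - 2 * (w / ζ).re := by
  have hζR : ‖ζ‖ = R := by simpa using hζ
  have hR : 0 < R := (norm_nonneg w).trans_lt hw
  have hζ0 : ζ ≠ 0 := norm_pos_iff.1 (hζR ▸ hR)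
  have hwζ : ζ ≠ w := by
    rintro rfl
    linarith
  have hq : ‖w‖ / R = ‖w / ζ‖ := by rw [norm_div, hζR]
  rw [hq]
  rcases le_total (1 / 2) ‖w / ζ‖ with h | h
  · linarith [one_add_two_re_le h, poissonKernel_nonneg hw hζ]
  · have e : poissonKernel 0 w ζ - 1 - 2 * (w / ζ).re
        = (herglotzRieszKernel 0 w ζ - 1 - 2 * (w / ζ)).re := by
      simp [poissonKernel_eq_re_herglotzRieszKernel]
    rw [e, herglotzRieszKernel_zero_sub_taylor hζ0 hwζ]
    have h1 : 1 / 2 ≤ ‖1 - w / ζ‖ := by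
      have := norm_sub_norm_le (1 : ℂ) (w / ζ)
      rw [norm_one] at this
      linarith
    have h2 : ‖2 * (w / ζ) ^ 2 / (1 - w / ζ)‖ ≤ 8 * ‖w / ζ‖ ^ 2 := by
      rw [norm_div, div_le_iff₀ (by linarith), norm_mul, norm_pow, Complex.norm_ofNat]
      nlinarith [sq_nonneg ‖w / ζ‖]
    linarith [neg_abs_le (2 * (w / ζ) ^ 2 / (1 - w / ζ)).re,
      Complex.abs_re_le_norm (2 * (w / ζ) ^ 2 / (1 - w / ζ))]

/-! ### The harmonic majorant with quadratic error -/

/-- A quantitative Schwarz lemma in terms of the `p`-th mean on a circle. -/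
lemma norm_rpow_le_mul_circleAverage {f : ℂ → ℂ} {w : ℂ} {R p : ℝ} (hp : 2 ≤ p) (hR : 0 < R)
    (hw : ‖w‖ < R / 2) (hf : DiffContOnCl ℂ f (ball 0 R)) (hf0 : f 0 = 0) :
    ‖f w‖ ^ p ≤ 3 * 2 ^ p * circleAverage (fun ζ ↦ ‖f ζ‖ ^ p) 0 R * (‖w‖ / R) ^ 2 := by
  have hp0 : 0 < p := by linarith
  set M := circleAverage (fun ζ ↦ ‖f ζ‖ ^ p) 0 R with hM_def
  have hM : 0 ≤ M := circleAverage_nonneg_of_nonneg fun _ _ ↦ by positivity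
  have hfc : ContinuousOn f (sphere 0 R) :=
    hf.2.mono (sphere_subset_closedBall.trans_eq (closure_ball 0 hR.ne').symm)
  have hg : ContinuousOn (fun ζ ↦ ‖f ζ‖ ^ p) (sphere 0 R) :=
    hfc.norm.rpow_const fun _ _ ↦ Or.inr hp0.le
  have hbound : ∀ z ∈ ball (0 : ℂ) (R / 2), ‖f z‖ ≤ (3 * M) ^ (1 / p) := by
    intro z hz
    have hz2 : ‖z‖ < R / 2 := mem_ball_zero_iff.1 hz
    have hzR : ‖z‖ < R := by linarith
    have h := norm_rpow_le_circleAverage_poissonKernel (by linarith : 1 ≤ p) hzR hf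
    have h' : ‖f z‖ ^ p ≤ 3 * M := by
      refine h.trans ?_
      rw [hM_def, ← smul_eq_mul, ← circleAverage_fun_smul]
      refine circleAverage_mono (((continuousOn_poissonKernel hzR).mul hg).circleIntegrable hR.le)
        ((continuousOn_const.mul hg).circleIntegrable hR.le) fun ζ hζ ↦ ?_
      rw [abs_of_pos hR] at hζ
      refine mul_le_mul_of_nonneg_right ((poissonKernel_le hzR hζ).trans ?_) (by positivity)
      -- For `‖z‖ < R / 2` the kernel is at most `(3R/2) / (R/2) = 3`.
      rw [div_le_iff₀ (by linarith)]
      linarith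
    rw [le_rpow_inv_iff_of_pos (norm_nonneg _) (by positivity) hp0 |>.symm] at h'
    simpa using h'
  have hS := Complex.dist_le_div_mul_dist_of_mapsTo_ball (f := f) (c := 0) (R₁ := R / 2)
    (R₂ := (3 * M) ^ (1 / p)) (z := w)
    (hf.1.mono (ball_subset_ball (by linarith)))
    (fun z hz ↦ by simpa [hf0] using hbound z hz) (mem_ball_zero_iff.2 hw)
  rw [hf0, dist_zero_right, dist_zero_right] at hS
  have e : (3 * M) ^ (1 / p) / (R / 2) * ‖w‖ = (3 * M) ^ (1 / p) * (2 * (‖w‖ / R)) := by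
    field_simp
  rw [e] at hS
  have hq : 0 ≤ ‖w‖ / R := by positivity
  have hq1 : ‖w‖ / R ≤ 1 := by
    rw [div_le_one hR]
    linarith
  calc ‖f w‖ ^ p ≤ ((3 * M) ^ (1 / p) * (2 * (‖w‖ / R))) ^ p :=
        rpow_le_rpow (norm_nonneg _) hS hp0.le
    _ = 3 * M * (2 ^ p * (‖w‖ / R) ^ p) := by
        rw [mul_rpow (by positivity) (by positivity), mul_rpow (by positivity) hq,
          ← rpow_mul (by positivity), one_div_mul_cancel hp0.ne', rpow_one]
    -- Here `p ≥ 2` is needed to lower the exponent of `‖w‖ / R ≤ 1`.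
    _ ≤ 3 * M * (2 ^ p * (‖w‖ / R) ^ (2 : ℝ)) := by
        gcongr 3 * M * (2 ^ p * ?_)
        rcases hq.eq_or_lt with h | h
        · rw [← h, zero_rpow hp0.ne', zero_rpow two_ne_zero]
        · exact rpow_le_rpow_of_exponent_ge h hq1 hp
    _ = _ := by
        rw [rpow_two]
        ring

/-- A holomorphic function vanishing at the origin satisfies `‖f‖ ^ p ≤ A M ‖w / R‖ ^ 2 + Re H`,
where `M` is the `p`-th mean of `f` on the circle of radius `R` and `H` is holomorphic and
vanishes at the origin. -/
lemma exists_re_majorant {f : ℂ → ℂ} {R p : ℝ} (hp : 2 ≤ p) (hR : 0 < R)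
    (hf : DiffContOnCl ℂ f (ball 0 R)) (hf0 : f 0 = 0) :
    ∃ H : ℂ → ℂ, DifferentiableOn ℂ H (ball 0 R) ∧ H 0 = 0 ∧ ∀ w : ℂ, ‖w‖ < R →
      ‖f w‖ ^ p ≤ (3 * 2 ^ p + 8) * circleAverage (fun ζ ↦ ‖f ζ‖ ^ p) 0 R * (‖w‖ / R) ^ 2
        + (H w).re := by
  have hp0 : 0 < p := by linarith
  set M := circleAverage (fun ζ ↦ ‖f ζ‖ ^ p) 0 R with hM_def
  have hM : 0 ≤ M := circleAverage_nonneg_of_nonneg fun _ _ ↦ by positivity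
  have hfc : ContinuousOn f (sphere 0 R) :=
    hf.2.mono (sphere_subset_closedBall.trans_eq (closure_ball 0 hR.ne').symm)
  have hg : ContinuousOn (fun ζ ↦ ‖f ζ‖ ^ p) (sphere 0 R) :=
    hfc.norm.rpow_const fun _ _ ↦ Or.inr hp0.le
  set g : ℂ → ℂ := fun ζ ↦ ((‖f ζ‖ ^ p : ℝ) : ℂ) with hg_def
  have hgC : ContinuousOn g (sphere 0 R) := Complex.continuous_ofReal.comp_continuousOn hg
  have hne : ∀ ζ ∈ sphere (0 : ℂ) R, ζ ≠ 0 := fun ζ hζ ↦ ne_of_mem_sphere hζ hR.ne'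
  have hinv : ContinuousOn (fun ζ : ℂ ↦ 2 * ζ⁻¹) (sphere 0 R) :=
    continuousOn_const.mul (continuousOn_inv₀.mono fun ζ hζ ↦ hne ζ hζ)
  -- The kernel expands as `1 + 2 * w / ζ + ⋯`, so `N + w * L` is the first order Taylor polynomial
  -- of `F`.
  let F : ℂ → ℂ := fun w ↦ circleAverage (fun ζ ↦ herglotzRieszKernel 0 w ζ • g ζ) 0 R
  let L : ℂ := circleAverage (fun ζ ↦ (2 * ζ⁻¹) • g ζ) 0 R
  let N : ℂ := circleAverage g 0 R
  have hFN : F 0 = N := by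
    refine circleAverage_congr_sphere fun ζ hζ ↦ ?_
    rw [abs_of_pos hR] at hζ
    simp [herglotzRieszKernel_def, hne ζ hζ]
  have hre : ∀ w : ℂ, ‖w‖ < R → (F w - N - w • L).re =
      circleAverage (fun ζ ↦ (poissonKernel 0 w ζ - 1 - 2 * (w / ζ).re) * ‖f ζ‖ ^ p) 0 R := by
    intro w hw
    have hk : ContinuousOn (herglotzRieszKernel 0 w) (sphere 0 R) := by
      simpa [abs_of_pos hR] using continuousOn_herglotzRieszKernel_sphere (mem_ball_zero_iff.2 hw)
    have i1 : CircleIntegrable (fun ζ ↦ herglotzRieszKernel 0 w ζ • g ζ) 0 R :=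
      (hk.smul hgC).circleIntegrable hR.le
    have i2 := hgC.circleIntegrable hR.le
    have i3 : CircleIntegrable (fun ζ ↦ w • ((2 * ζ⁻¹) • g ζ)) 0 R :=
      (continuousOn_const.mul (hinv.mul hgC)).circleIntegrable hR.le
    rw [← circleAverage_fun_smul, ← circleAverage_sub i1 i2, ← circleAverage_sub
      (i1.sub i2) i3]
    refine (Complex.reCLM.circleAverage_comp_comm ((i1.sub i2).sub i3)).symm.trans
      (circleAverage_congr_sphere fun ζ hζ ↦ ?_)
    have e : herglotzRieszKernel 0 w ζ • g ζ - g ζ - w • ((2 * ζ⁻¹) • g ζ)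
        = (herglotzRieszKernel 0 w ζ - 1 - 2 * (w / ζ)) * ((‖f ζ‖ ^ p : ℝ) : ℂ) := by
      simp only [smul_eq_mul, hg_def]
      ring
    change (herglotzRieszKernel 0 w ζ • g ζ - g ζ - w • ((2 * ζ⁻¹) • g ζ)).re = _
    rw [e, Complex.re_mul_ofReal]
    simp [poissonKernel_eq_re_herglotzRieszKernel]
  have hlin : ∀ w : ℂ, ContinuousOn (fun ζ : ℂ ↦ (w / ζ).re) (sphere 0 R) := fun w ↦
    Complex.continuous_re.comp_continuousOn (continuousOn_const.div continuousOn_id hne)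
  refine ⟨fun w ↦ F w - N - w • L, ?_, by simp [hFN], fun w hw ↦ ?_⟩
  · have hF := differentiableOn_circleAverage_herglotzRieszKernel_smul (f := g)
      (hgC.circleIntegrable hR.le)
    exact (hF.sub_const N).sub (differentiableOn_id.smul_const L)
  rw [hre w hw]
  have hPc := continuousOn_poissonKernel hw
  have hTc : ContinuousOn (fun ζ ↦ (poissonKernel 0 w ζ - 1 - 2 * (w / ζ).re) * ‖f ζ‖ ^ p)
      (sphere 0 R) :=
    ((hPc.sub continuousOn_const).sub (continuousOn_const.mul (hlin w))).mul hg
  have hgi : ∀ c : ℝ, CircleIntegrable (fun ζ ↦ c • ‖f ζ‖ ^ p) 0 R := fun c ↦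
    (continuousOn_const.mul hg).circleIntegrable hR.le
  rcases lt_or_ge ‖w‖ (R / 2) with h | h
  · have h1 := norm_rpow_le_mul_circleAverage hp hR h hf hf0
    have h2 : -(8 * (‖w‖ / R) ^ 2) * M ≤
        circleAverage (fun ζ ↦ (poissonKernel 0 w ζ - 1 - 2 * (w / ζ).re) * ‖f ζ‖ ^ p) 0 R := by
      rw [hM_def, ← smul_eq_mul, ← circleAverage_fun_smul]
      refine circleAverage_mono (hgi _) (hTc.circleIntegrable hR.le) fun ζ hζ ↦ ?_
      rw [abs_of_pos hR] at hζ
      exact mul_le_mul_of_nonneg_right (neg_le_poissonKernel_sub_taylor hw hζ) (by positivity)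
    rw [← hM_def] at h1
    linarith
  · have h1 := norm_rpow_le_circleAverage_poissonKernel (by linarith : 1 ≤ p) hw hf
    have h2 : circleAverage (fun ζ ↦ poissonKernel 0 w ζ * ‖f ζ‖ ^ p) 0 R ≤
        8 * (‖w‖ / R) ^ 2 * M +
        circleAverage (fun ζ ↦ (poissonKernel 0 w ζ - 1 - 2 * (w / ζ).re) * ‖f ζ‖ ^ p) 0 R := by
      rw [hM_def, ← smul_eq_mul, ← circleAverage_fun_smul,
        ← circleAverage_fun_add (hgi _) (hTc.circleIntegrable hR.le)]
      refine circleAverage_mono ((hPc.mul hg).circleIntegrable hR.le)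
        ((hgi _).add (hTc.circleIntegrable hR.le)) fun ζ hζ ↦ ?_
      rw [abs_of_pos hR] at hζ
      have hq : ‖w‖ / R = ‖w / ζ‖ := by rw [norm_div, mem_sphere_zero_iff_norm.1 hζ]
      have h3 := one_add_two_re_le (q := w / ζ) (by rw [← hq, le_div_iff₀ hR]; linarith)
      rw [hq, smul_eq_mul, ← add_mul]
      exact mul_le_mul_of_nonneg_right (by linarith) (by positivity)
    have h3 : 0 ≤ 3 * 2 ^ p * M * (‖w‖ / R) ^ 2 := by positivity
    linarith

/-! ### Composition with the self-map -/

lemma circleAverage_norm_rpow_comp_le {f φ : ℂ → ℂ} {r R p : ℝ} (hp : 2 ≤ p) (hr : 0 < r)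
    (hrR : r < R) (hR : R < 1) (hf : AnalyticOnNhd ℂ f (ball 0 1)) (hφ : IsAnalyticSelfMap φ)
    (hf0 : f 0 = 0) (hφ0 : φ 0 = 0) :
    circleAverage (fun z ↦ ‖f (φ z)‖ ^ p) 0 r ≤
      (3 * 2 ^ p + 8) * circleAverage (fun ζ ↦ ‖f ζ‖ ^ p) 0 R / R ^ 2
        * circleAverage (fun z ↦ ‖φ z‖ ^ 2) 0 r := by
  have hR0 : 0 < R := hr.trans hrR
  have hfR : DiffContOnCl ℂ f (ball 0 R) := by
    refine (hf.differentiableOn.mono ?_).diffContOnCl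
    rw [closure_ball 0 hR0.ne']
    exact closedBall_subset_ball hR
  obtain ⟨H, hH, hH0, hle⟩ := exists_re_majorant hp hR0 hfR hf0
  set M := circleAverage (fun ζ ↦ ‖f ζ‖ ^ p) 0 R
  -- By Schwarz, `‖φ z‖ ≤ ‖z‖ ≤ r < R`, so `φ z` stays where `H` is holomorphic.
  have hφle : ∀ z ∈ closedBall (0 : ℂ) r, ‖φ z‖ < R := fun z hz ↦ by
    have hz' : ‖z‖ ≤ r := mem_closedBall_zero_iff.1 hz
    have := Complex.norm_le_norm_of_mapsTo_ball hφ.1.differentiableOn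
      (hφ.2.mono_right ball_subset_closedBall) hφ0 (by linarith : ‖z‖ < 1)
    linarith
  have hsub : closedBall (0 : ℂ) r ⊆ ball 0 1 := closedBall_subset_ball (hrR.trans hR)
  have hφd : DifferentiableOn ℂ φ (closedBall 0 r) := hφ.1.differentiableOn.mono hsub
  have hHφ : DifferentiableOn ℂ (H ∘ φ) (closedBall 0 r) :=
    hH.comp hφd fun z hz ↦ mem_ball_zero_iff.2 (hφle z hz)
  have hHi : CircleIntegrable (H ∘ φ) 0 r :=
    (hHφ.continuousOn.mono sphere_subset_closedBall).circleIntegrable hr.le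
  have hmean : circleAverage (fun z ↦ (H (φ z)).re) 0 r = 0 := by
    have h1 : circleAverage (H ∘ φ) 0 r = 0 := by
      have h : DiffContOnCl ℂ (H ∘ φ) (ball 0 |r|) := by
        rw [abs_of_pos hr]
        exact DifferentiableOn.diffContOnCl (by rwa [closure_ball 0 hr.ne'])
      simpa [hφ0, hH0] using h.circleAverage
    have h2 := Complex.reCLM.circleAverage_comp_comm hHi
    rw [h1, map_zero] at h2
    exact h2
  have hφc : ContinuousOn φ (sphere 0 r) := hφd.continuousOn.mono sphere_subset_closedBall
  have hfφc : ContinuousOn (fun z ↦ ‖f (φ z)‖ ^ p) (sphere 0 r) := by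
    refine ContinuousOn.rpow_const (ContinuousOn.norm ?_) fun _ _ ↦ Or.inr (by linarith)
    exact hf.continuousOn.comp hφc fun z hz ↦ hφ.2 (hsub (sphere_subset_closedBall hz))
  have hHc : CircleIntegrable (fun z ↦ (H (φ z)).re) 0 r :=
    (Complex.continuous_re.comp_continuousOn
      (hHφ.continuousOn.mono sphere_subset_closedBall)).circleIntegrable hr.le
  have hφ2 : CircleIntegrable (fun z ↦ ((3 * 2 ^ p + 8) * M / R ^ 2) • ‖φ z‖ ^ 2) 0 r :=
    (continuousOn_const.mul (hφc.norm.pow 2)).circleIntegrable hr.le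
  calc circleAverage (fun z ↦ ‖f (φ z)‖ ^ p) 0 r
      ≤ circleAverage (fun z ↦ ((3 * 2 ^ p + 8) * M / R ^ 2) • ‖φ z‖ ^ 2 + (H (φ z)).re) 0 r := by
        refine circleAverage_mono (hfφc.circleIntegrable hr.le) (hφ2.add hHc) fun z hz ↦ ?_
        rw [abs_of_pos hr] at hz
        refine (hle _ (hφle z (sphere_subset_closedBall hz))).trans (le_of_eq ?_)
        rw [smul_eq_mul, div_pow]
        ring
    _ = _ := by
        rw [circleAverage_fun_add hφ2 hHc, hmean, circleAverage_fun_smul, add_zero, smul_eq_mul]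

lemma circleAverage_norm_sq_le {φ : ℂ → ℂ} {r p : ℝ} (hp : 2 ≤ p) (hr : 0 ≤ r)
    (hφ : ContinuousOn φ (sphere 0 r)) :
    circleAverage (fun z ↦ ‖φ z‖ ^ 2) 0 r ≤ circleAverage (fun z ↦ ‖φ z‖ ^ p) 0 r ^ (2 / p) := by
  have hp0 : 0 < p := by linarith
  have h := rpow_circleAverage_mul_le (k := fun _ ↦ 1) (x := fun z ↦ ‖φ z‖ ^ 2) (p := p / 2)
    (by linarith) hr continuousOn_const (hφ.norm.pow 2) (fun _ _ ↦ zero_le_one)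
    (fun _ _ ↦ by positivity) (circleAverage_const _ _ _)
  have e : ∀ z, (‖φ z‖ ^ 2) ^ (p / 2) = ‖φ z‖ ^ p := fun z ↦ by
    rw [← rpow_natCast, ← rpow_mul (norm_nonneg _)]
    congr 1
    push_cast
    ring
  simp only [one_mul, e] at h
  have h0 : 0 ≤ circleAverage (fun z ↦ ‖φ z‖ ^ 2) 0 r :=
    circleAverage_nonneg_of_nonneg fun _ _ ↦ by positivity
  calc _ = (circleAverage (fun z ↦ ‖φ z‖ ^ 2) 0 r ^ (p / 2)) ^ (2 / p) := by
        rw [← rpow_mul h0, div_mul_div_cancel₀ two_ne_zero, div_self hp0.ne', rpow_one]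
    _ ≤ _ := rpow_le_rpow (by positivity) h (by positivity)

/-! ### Hardy norms and conclusion -/

lemma dilateNorm_eq_ofReal_circleAverage {f : ℂ → ℂ} {r p : ℝ} (hp : 0 < p) (hr : 0 ≤ r)
    (hf : ContinuousOn f (sphere 0 r)) :
    dilateNorm p r f = ENNReal.ofReal (circleAverage (fun z ↦ ‖f z‖ ^ p) 0 r) ^ (1 / p) := by
  have hi : CircleIntegrable (fun z ↦ ‖f z‖ ^ p) 0 r :=
    (hf.norm.rpow_const fun _ _ ↦ Or.inr hp.le).circleIntegrable hr
  have hi' := (intervalIntegrable_iff_integrableOn_Ioc_of_le two_pi_pos.le).1 hi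
  rw [dilateNorm, circleAverage_def, smul_eq_mul, ENNReal.ofReal_mul (p := (2 * π)⁻¹) (by positivity),
    ENNReal.ofReal_inv_of_pos two_pi_pos, intervalIntegral.integral_of_le two_pi_pos.le,
    MeasureTheory.ofReal_integral_eq_lintegral_ofReal hi'
      (Filter.Eventually.of_forall fun _ ↦ by positivity)]
  congr 3
  ext θ
  rw [← ENNReal.ofReal_rpow_of_nonneg (norm_nonneg _) hp.le, ofReal_norm]

/-- Serves only to make the right-hand side finite, hence `f ∘ φ ∈ H^p`. -/
lemma hardyNorm_le_one {φ : ℂ → ℂ} {p : ℝ} (hp : 0 < p) (hφ : IsAnalyticSelfMap φ) :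
    hardyNorm p φ ≤ 1 := by
  refine iSup₂_le fun r hr ↦ ?_
  have hsub : sphere (0 : ℂ) r ⊆ ball 0 1 :=
    sphere_subset_closedBall.trans (closedBall_subset_ball hr.2)
  have hc := hφ.1.continuousOn.mono hsub
  rw [dilateNorm_eq_ofReal_circleAverage hp hr.1.le hc]
  refine ENNReal.rpow_le_one (ENNReal.ofReal_le_one.2 ?_) (by positivity)
  refine circleAverage_mono_on_of_le_circle
    ((hc.norm.rpow_const fun _ _ ↦ Or.inr hp.le).circleIntegrable hr.1.le) fun z hz ↦ ?_
  rw [abs_of_pos hr.1] at hz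
  exact rpow_le_one (norm_nonneg _) (mem_ball_zero_iff.1 (hφ.2 (hsub hz))).le hp.le

theorem theorem4p1 (p : ℝ) (hp : 2 ≤ p) :
    ∃ C : ℝ, 0 < C ∧ ∀ f φ : ℂ → ℂ, MemHardy p f → IsAnalyticSelfMap φ → f 0 = 0 → φ 0 = 0 →
      MemHardy p (f ∘ φ) ∧
        hardyNorm p (f ∘ φ) ≤ ENNReal.ofReal C * hardyNorm p f * hardyNorm p φ ^ (2 / p) := by
  have hp0 : 0 < p := by linarith
  -- The factor 4 absorbs `1 / R ^ 2`, as `R = (1 + r) / 2 > 1/2`.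
  set A : ℝ := 4 * (3 * 2 ^ p + 8) with hA_def
  have hA : 0 < A := by positivity
  refine ⟨A ^ (1 / p), by positivity, fun f φ hf hφ hf0 hφ0 ↦ ?_⟩
  have hle : hardyNorm p (f ∘ φ) ≤
      ENNReal.ofReal (A ^ (1 / p)) * hardyNorm p f * hardyNorm p φ ^ (2 / p) := by
    refine iSup₂_le fun r hr ↦ ?_
    obtain ⟨hr0, hr1⟩ := hr
    set R := (1 + r) / 2 with hR_def
    have hrR : r < R := by linarith
    have hR1 : R < 1 := by linarith
    have hR0 : 0 < R := by linarith
    have hsub : ∀ {s : ℝ}, s < 1 → sphere (0 : ℂ) s ⊆ ball 0 1 := fun hs ↦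
      sphere_subset_closedBall.trans (closedBall_subset_ball hs)
    have hφc := hφ.1.continuousOn.mono (hsub hr1)
    have hfφc : ContinuousOn (f ∘ φ) (sphere 0 r) :=
      hf.1.continuousOn.comp hφc fun z hz ↦ hφ.2 (hsub hr1 hz)
    have hM : 0 ≤ circleAverage (fun ζ ↦ ‖f ζ‖ ^ p) 0 R :=
      circleAverage_nonneg_of_nonneg fun _ _ ↦ by positivity
    have hK : 0 ≤ circleAverage (fun z ↦ ‖φ z‖ ^ p) 0 r :=
      circleAverage_nonneg_of_nonneg fun _ _ ↦ by positivity
    have key : circleAverage (fun z ↦ ‖(f ∘ φ) z‖ ^ p) 0 r ≤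
        A * circleAverage (fun ζ ↦ ‖f ζ‖ ^ p) 0 R *
          circleAverage (fun z ↦ ‖φ z‖ ^ p) 0 r ^ (2 / p) := by
      refine (circleAverage_norm_rpow_comp_le hp hr0 hrR hR1 hf.1 hφ hf0 hφ0).trans ?_
      refine mul_le_mul ?_ (circleAverage_norm_sq_le hp hr0.le hφc)
        (circleAverage_nonneg_of_nonneg fun _ _ ↦ by positivity) (by positivity)
      rw [div_le_iff₀ (by positivity)]
      have h4 : 1 ≤ 4 * R ^ 2 := by nlinarith
      have h5 : 0 ≤ (3 * 2 ^ p + 8) * circleAverage (fun ζ ↦ ‖f ζ‖ ^ p) 0 R := by positivity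
      rw [hA_def]
      nlinarith
    calc dilateNorm p r (f ∘ φ)
        ≤ (ENNReal.ofReal A * ENNReal.ofReal (circleAverage (fun ζ ↦ ‖f ζ‖ ^ p) 0 R) *
          ENNReal.ofReal (circleAverage (fun z ↦ ‖φ z‖ ^ p) 0 r) ^ (2 / p)) ^ (1 / p) := by
          rw [dilateNorm_eq_ofReal_circleAverage hp0 hr0.le hfφc,
            ENNReal.ofReal_rpow_of_nonneg hK (by positivity), ← ENNReal.ofReal_mul hA.le,
            ← ENNReal.ofReal_mul (by positivity)]
          exact ENNReal.rpow_le_rpow (ENNReal.ofReal_le_ofReal key) (by positivity)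
      _ = ENNReal.ofReal (A ^ (1 / p)) * dilateNorm p R f * dilateNorm p r φ ^ (2 / p) := by
          rw [dilateNorm_eq_ofReal_circleAverage hp0 hR0.le (hf.1.continuousOn.mono (hsub hR1)),
            dilateNorm_eq_ofReal_circleAverage hp0 hr0.le hφc,
            ENNReal.mul_rpow_of_nonneg _ _ (by positivity),
            ENNReal.mul_rpow_of_nonneg _ _ (by positivity),
            ENNReal.ofReal_rpow_of_nonneg hA.le (by positivity), ← ENNReal.rpow_mul,
            ← ENNReal.rpow_mul, mul_comm (2 / p)]
      _ ≤ _ := by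
          gcongr
          · exact le_iSup₂_of_le R ⟨hR0, hR1⟩ le_rfl
          · exact le_iSup₂_of_le r ⟨hr0, hr1⟩ le_rfl
  refine ⟨⟨hf.1.comp hφ.1 hφ.2, hle.trans_lt ?_⟩, hle⟩
  refine ENNReal.mul_lt_top (ENNReal.mul_lt_top ENNReal.ofReal_lt_top hf.2) ?_
  exact ENNReal.rpow_lt_top_of_nonneg (by positivity)
    ((hardyNorm_le_one hp0 hφ).trans_lt ENNReal.one_lt_top).ne
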